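/- Let $K$ be an algebraically closed topological field whose topology is neither discrete nor coarse. For a $K$-scheme $X$ of finite type, let $X_{\mathrm{top}}$ be the set $X(K)$ of $K$-rational points with its strong topology, that is, the topology generated by the sets $\{x\in U(K) : g(x)\in V\}$, where $U\subseteq X$ is Zariski open, $g\in\mathcal{O}_X(U)$ and $V\subseteq K$ is open (on an affine open $U$ it is the topology induced from $K^n$ by any closed immersion $U\hookrightarrow\mathbb{A}^n_K$). For a $K$-morphism $f:X\to Y$ of $K$-schemes of finite type, let $f_{\mathrm{top}}:X_{\mathrm{top}}\to Y_{\mathrm{top}}$ be the induced map. Suppose that $K$ satisfies the condition (H) for every étale $K$-morphism $g:X'\to Y'$ of $K$-schemes of finite type, the map $g_{\mathrm{top}}$ is open. Let $f:X\to Y$ be a $K$-morphism of $K$-schemes of finite type. If $f_{\mathrm{top}}$ is open, then $f$ is universally open. -/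

import Mathlib

open CategoryTheory AlgebraicGeometry

universe u

namespace StrongTopology

variable {K : Type u} [Field K]

/-- The `K`-scheme `X` is of finite type over `K`. -/
def IsFiniteType (X : Over (Spec (.of K))) : Prop :=
  LocallyOfFiniteType X.hom ∧ QuasiCompact X.hom

/-- A `K`-rational point of a `K`-scheme `X`: a morphism `Spec K ⟶ X` over `Spec K`. The type
`Points X` is the set `X(K)`. -/
@[ext]
structure Points (X : Over (Spec (.of K))) where
  /-- the underlying morphism of schemes -/
  hom : Spec (.of K) ⟶ X.left
  w : hom ≫ X.hom = 𝟙 (Spec (.of K))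

/-- The map `X(K) → Y(K)` induced by a `K`-morphism `X ⟶ Y`. -/
noncomputable def Points.map {X Y : Over (Spec (.of K))} (f : X ⟶ Y) (x : Points X) : Points Y where
  hom := x.hom ≫ f.left
  w := by rw [Category.assoc, Over.w, x.w]

/-- The value `g(x) ∈ K` of a global function `g` on `X` at a rational point `x ∈ X(K)`. -/
noncomputable def Points.value {X : Over (Spec (.of K))} (x : Points X) (g : Γ(X.left, ⊤)) : K :=
  (Scheme.ΓSpecIso (.of K)).hom (x.hom.appTop g)

/-- A Zariski open subset of a `K`-scheme, as a `K`-scheme. -/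
noncomputable abbrev openSub (X : Over (Spec (.of K))) (U : X.left.Opens) : Over (Spec (.of K)) :=
  Over.mk (U.ι ≫ X.hom)

/-- The inclusion of a Zariski open subset, as a `K`-morphism. -/
noncomputable abbrev openSubι (X : Over (Spec (.of K))) (U : X.left.Opens) : openSub X U ⟶ X :=
  Over.homMk U.ι

/-- The strong topology on `X(K)`: it is generated by the sets `{x ∈ U(K) | g(x) ∈ V}`, where `U`
is a Zariski open subset of `X`, `g` a regular function on `U` and `V` an open subset of `K`.
Equivalently, it is the coarsest topology for which every `U(K)` is open in `X(K)` and every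
regular function `g` on `U` induces a continuous map `U(K) → K`. For a Hausdorff topological
field `K` this is the topology glued from those of the affine open subsets `U` of `X`, where
`U(K)` is a subspace of `K ^ n` for any closed immersion of `U` into affine `n`-space. -/
instance strongTopology [TopologicalSpace K] (X : Over (Spec (.of K))) :
    TopologicalSpace (Points X) :=
  TopologicalSpace.generateFrom
    {S | ∃ (U : X.left.Opens) (g : Γ((openSub X U).left, ⊤)) (V : Set K), IsOpen V ∧
      S = Points.map (openSubι X U) '' {y | y.value g ∈ V}}

/-- Condition (H): every étale `K`-morphism `X ⟶ Y` of `K`-schemes of finite type induces an open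
map `X(K) → Y(K)` for the strong topologies. -/
def ConditionH (K : Type u) [Field K] [TopologicalSpace K] : Prop :=
  ∀ (X Y : Over (Spec (.of K))), IsFiniteType X → IsFiniteType Y →
    ∀ f : X ⟶ Y, Etale f.left → IsOpenMap (Points.map f)

end StrongTopology

/-! Universal openness is local on source and target, and open immersions induce open injections on
rational points, so the problem concerns a map `φ : A →ₐ[K] B` of finitely generated algebras. For
affine `X` the strong topology is pointwise convergence on `A →ₐ[K] K`. Polynomial variables
therefore only multiply the map on points by the identity of `K ^ n`, and strong openness survives
base change to affine spaces. Conversely, Zariski openness after base change to every affine space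
already gives universal openness (`isOpenMap_comap_tensorProduct`): an element of `A' ⊗ B` involves
finitely many coefficients from `A'`.

It remains to deduce Zariski openness from strong openness (`isOpen_comap_image_basicOpen`). The
image of a basic open set is constructible by Chevalley, so stability under generalization suffices.
If `q` lies in the image and its generalization `p` does not, a nonempty Zariski open part of the
closure of `p` misses the image. But the image contains a strong neighbourhood of some rational
point of the closure of `q`, contradicting strong density of that open part.

The density statement, `exists_mem_of_isOpen`, is where (H) enters. Through the given point one
draws a curve not contained in the bad hypersurface, normalises it, and maps it étale to the line.
By (H) a strong neighbourhood on the curve has open, hence infinite, image in the line, while the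
hypersurface meets the curve in finitely many points. -/

namespace StrongTopology

/-! ### Rational points of algebras, the Nullstellensatz, and the topology of `K`. -/

section AlgebraPoints

variable {K : Type u} [Field K] {A B : Type u} [CommRing A] [Algebra K A] [CommRing B] [Algebra K B]

/-- The topology of pointwise convergence on the set of `K`-points of a `K`-algebra. -/
instance algHomTopology [TopologicalSpace K] : TopologicalSpace (A →ₐ[K] K) :=
  .induced (fun x (a : A) ↦ x a) inferInstance

lemma continuous_algHom_iff [TopologicalSpace K] {T : Type*} [TopologicalSpace T]
    {f : T → (A →ₐ[K] K)} : Continuous f ↔ ∀ a, Continuous fun t ↦ f t a := by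
  rw [continuous_induced_rng, continuous_pi_iff]
  rfl

lemma continuous_algHom_apply [TopologicalSpace K] (a : A) :
    Continuous fun x : A →ₐ[K] K ↦ x a :=
  continuous_algHom_iff.mp continuous_id a

lemma continuous_comp_algHom [TopologicalSpace K] (φ : A →ₐ[K] B) :
    Continuous fun y : B →ₐ[K] K ↦ y.comp φ :=
  continuous_algHom_iff.mpr fun a ↦ continuous_algHom_apply (φ a)

/-- A point of a polynomial algebra is a point of the coefficient algebra together with a tuple
of coordinates. -/
noncomputable def mvPolynomialPoints [TopologicalSpace K] [IsTopologicalRing K] (σ : Type) :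
    (MvPolynomial σ B →ₐ[K] K) ≃ₜ (B →ₐ[K] K) × (σ → K) where
  toFun x := (x.comp (IsScalarTower.toAlgHom K B (MvPolynomial σ B)), fun i ↦ x (.X i))
  invFun y :=
    { MvPolynomial.eval₂Hom y.1.toRingHom y.2 with
      commutes' := fun r ↦ by
        simp }
  left_inv x := by
    refine AlgHom.coe_ringHom_injective (MvPolynomial.ringHom_ext (fun b ↦ ?_) fun i ↦ ?_) <;>
      simp [MvPolynomial.algebraMap_eq]
  right_inv y := by
    ext <;> simp [MvPolynomial.algebraMap_eq]
  continuous_toFun :=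
    (continuous_comp_algHom _).prodMk (continuous_pi fun i ↦ continuous_algHom_apply _)
  continuous_invFun := by
    rw [continuous_algHom_iff]
    intro p
    change Continuous fun y : (B →ₐ[K] K) × (σ → K) ↦ MvPolynomial.eval₂Hom y.1.toRingHom y.2 p
    induction p using MvPolynomial.induction_on with
    | C b => 
      simp only [MvPolynomial.eval₂Hom_C]
      exact (continuous_algHom_apply b).comp continuous_fst
    | add p q hp hq => 
      simp only [map_add]
      exact hp.add hq
    | mul_X p i hp =>
      simp only [map_mul]
      refine hp.mul ?_
      simp only [MvPolynomial.eval₂Hom_X']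
      exact (continuous_apply i).comp continuous_snd

/-- Under `mvPolynomialPoints` the map becomes a product with the identity of `σ → K`. -/
lemma isOpenMap_comp_mapAlgHom [TopologicalSpace K] [IsTopologicalRing K] {φ : A →ₐ[K] B}
    (hφ : IsOpenMap fun y : B →ₐ[K] K ↦ y.comp φ) (σ : Type) :
    IsOpenMap fun y : MvPolynomial σ B →ₐ[K] K ↦
      y.comp (MvPolynomial.mapAlgHom (σ := σ) φ) := by
  have : (fun y : MvPolynomial σ B →ₐ[K] K ↦ y.comp (MvPolynomial.mapAlgHom (σ := σ) φ)) =
      (mvPolynomialPoints σ).symm ∘ Prod.map (fun y ↦ y.comp φ) id ∘ mvPolynomialPoints σ := by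
    funext y
    apply (mvPolynomialPoints σ).injective
    rw [Function.comp_apply, Homeomorph.apply_symm_apply]
    ext <;> simp [mvPolynomialPoints, MvPolynomial.algebraMap_eq]
  rw [this]
  exact (mvPolynomialPoints σ).symm.isOpenMap.comp
    ((hφ.prodMap IsOpenMap.id).comp (mvPolynomialPoints σ).isOpenMap)

lemma ker_algHom_isMaximal (x : A →ₐ[K] K) : (RingHom.ker x).IsMaximal :=
  RingHom.ker_isMaximal_of_surjective x fun r ↦ ⟨algebraMap K A r, by simp⟩

lemma algHom_ext_of_ker_le {x y : A →ₐ[K] K} (h : RingHom.ker x ≤ RingHom.ker y) : x = y := by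
  ext a
  have : a - algebraMap K A (x a) ∈ RingHom.ker y := h (by simp)
  simpa [sub_eq_zero, RingHom.mem_ker] using (sub_eq_zero.mp (by simpa using this)).symm

/-- Nullstellensatz: maximal ideals of finitely generated algebras over algebraically closed
fields are kernels of rational points. -/
lemma exists_algHom_ker_eq [IsAlgClosed K] [Algebra.FiniteType K A] (m : Ideal A)
    [hm : m.IsMaximal] : ∃ x : A →ₐ[K] K, RingHom.ker x = m := by
  let := Ideal.Quotient.field m
  have : Module.Finite K (A ⧸ m) := finite_of_finite_type_of_isJacobsonRing K (A ⧸ m)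
  let e : K ≃ₐ[K] A ⧸ m := AlgEquiv.ofBijective (Algebra.ofId K (A ⧸ m))
    (IsAlgClosed.algebraMap_bijective_of_isIntegral (k := K) (K := A ⧸ m))
  refine ⟨e.symm.toAlgHom.comp (Ideal.Quotient.mkₐ K m), ?_⟩
  ext a
  simp [RingHom.mem_ker, Ideal.Quotient.eq_zero_iff_mem]

/-- A point of a basic open subset of the spectrum specialises to a rational point of it. -/
lemma exists_algHom_le_ker [IsAlgClosed K] [Algebra.FiniteType K A] (p : Ideal A)
    [hp : p.IsPrime] {a : A} (ha : a ∉ p) : ∃ x : A →ₐ[K] K, p ≤ RingHom.ker x ∧ x a ≠ 0 := by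
  have : IsJacobsonRing A := isJacobsonRing_of_finiteType (A := K)
  have h : p.jacobson = p := this.out' p hp.isRadical
  rw [← h, Ideal.jacobson, Ideal.mem_sInf] at ha
  push Not at ha
  obtain ⟨m, ⟨hpm, hm⟩, ham⟩ := ha
  obtain ⟨x, rfl⟩ := exists_algHom_ker_eq (K := K) m
  exact ⟨x, hpm, ham⟩

/-- An affine map carries any two distinct points to any two others, so a single inseparable pair of
distinct points would make the topology coarse. -/
lemma t1Space_of_nontrivialTopology [TopologicalSpace K] [IsTopologicalRing K]
    [NontrivialTopology K] : T1Space K := by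
  have : T0Space K := by
    refine ⟨fun x y hxy ↦ by_contra fun hne ↦ ?_⟩
    obtain ⟨a, b, hab⟩ :=
      TopologicalSpace.nontrivial_iff_exists_not_inseparable.mp ‹NontrivialTopology K›
    refine hab ?_
    have hc : Continuous fun z : K ↦ a + (z - x) * ((y - x)⁻¹ * (b - a)) := by fun_prop
    have := hxy.map hc
    rwa [sub_self, zero_mul, add_zero, ← mul_assoc, mul_inv_cancel₀ (sub_ne_zero.mpr (Ne.symm hne)),
      one_mul, add_sub_cancel] at this
  infer_instance

/-- A finite open set in a T1 space has isolated points, and a translation moves one to `0`. -/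
lemma infinite_of_isOpen [TopologicalSpace K] [IsTopologicalRing K]
    [T1Space K] (hK : ¬ DiscreteTopology K) {V : Set K} (hV : IsOpen V) (hne : V.Nonempty) :
    V.Infinite := by
  intro hfin
  obtain ⟨a, ha⟩ := hne
  apply hK
  apply discreteTopology_of_isOpen_singleton_zero
  have h1 : IsOpen ({a} : Set K) := by
    have : ({a} : Set K) = V ∩ (V \ {a})ᶜ := by
      ext b; simp; grind
    rw [this]
    exact hV.inter (hfin.subset Set.sdiff_subset).isClosed.isOpen_compl
  have : ({0} : Set K) = (fun b ↦ b + a) ⁻¹' {a} := by ext; simp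
  rw [this]
  exact h1.preimage (by fun_prop)

end AlgebraPoints

/-! ### Curves through a point, by Noether normalisation and going down. -/

section Curve

open Polynomial

variable {K : Type u} [Field K] {A : Type u} [CommRing A] [Algebra K A]

/-- Through a rational point on a hypersurface of an irreducible affine variety there passes an
irreducible curve not contained in the hypersurface. -/
lemma exists_prime_finite_polynomial [Infinite K] [IsDomain A] [Algebra.FiniteType K A]
    (x : A →ₐ[K] K) {h : A} (hh : h ≠ 0) (hx : x h = 0) :
    ∃ P : Ideal A, P.IsPrime ∧ P ≤ RingHom.ker x ∧ h ∉ P ∧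
      ∃ τ : K[X] →ₐ[K] A ⧸ P, τ.toRingHom.Finite := by
  obtain ⟨s, g, hgi, hgf⟩ := exists_finite_inj_algHom_of_fg K A
  algebraize [g.toRingHom]
  have : FaithfulSMul (MvPolynomial (Fin s) K) A :=
    (faithfulSMul_iff_algebraMap_injective _ _).mpr hgi
  have : Module.Finite (MvPolynomial (Fin s) K) A := hgf
  -- A nonzero multiple of `h` coming from the polynomial ring: it suffices to keep the curve off
  -- the zeros of `N`.
  obtain ⟨N, hN0, hN⟩ : ∃ N : MvPolynomial (Fin s) K, N ≠ 0 ∧ h ∣ g N := by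
    have h1 := Ideal.comap_ne_bot_of_integral_mem (R := MvPolynomial (Fin s) K)
      (I := Ideal.span {h}) hh (Ideal.mem_span_singleton_self h)
      (Algebra.IsIntegral.isIntegral h)
    obtain ⟨N, hN, hN0⟩ := Submodule.exists_mem_ne_zero_of_ne_bot h1
    exact ⟨N, hN0, Ideal.mem_span_singleton.mp hN⟩
  obtain ⟨d, hd⟩ : ∃ d : Fin s → K, MvPolynomial.eval d N ≠ 0 := by
    by_contra! H
    exact hN0 (MvPolynomial.funext fun d ↦ by simp [H d])
  let c : Fin s → K := fun i ↦ x (g (.X i))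
  have hxg : ∀ q, x (g q) = MvPolynomial.eval c q := fun q ↦ by
    have : x.comp g = MvPolynomial.aeval c := by ext; simp [c]
    simpa using congr($this q)
  obtain ⟨i, hi⟩ : ∃ i, d i ≠ c i := by
    by_contra! H
    obtain rfl : d = c := funext H
    obtain ⟨b, hb⟩ := hN
    exact hd (by rw [← hxg, hb, map_mul, hx, zero_mul])
  -- Restriction to the line through `c`, the image of `x`, at parameter `0`, and `d`, where `N`
  -- does not vanish, at parameter `1`. The map `σ` is a section, reading the parameter off the
  -- coordinate `i`.
  let γ : MvPolynomial (Fin s) K →ₐ[K] K[X] :=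
    MvPolynomial.aeval fun j ↦ Polynomial.C (c j) + Polynomial.X * Polynomial.C (d j - c j)
  let σ : K[X] →ₐ[K] MvPolynomial (Fin s) K :=
    Polynomial.aeval (MvPolynomial.C (d i - c i)⁻¹ * (MvPolynomial.X i - MvPolynomial.C (c i)))
  have hγσ : ∀ q, γ (σ q) = q := by
    have : γ.comp σ = AlgHom.id K _ := by
      ext
      simp only [σ, γ, AlgHom.coe_comp, Function.comp_apply, aeval_X, map_mul, map_sub,
        MvPolynomial.aeval_X, MvPolynomial.algHom_C, AlgHom.id_apply, add_sub_cancel_left,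
        Polynomial.algebraMap_eq]
      rw [mul_left_comm, ← map_sub, ← Polynomial.C_mul, inv_mul_cancel₀ (sub_ne_zero.mpr hi)]
      simp
    exact fun q ↦ congr($this q)
  have hev (r : K) (q) : (γ q).eval r = MvPolynomial.eval (fun j ↦ c j + r * (d j - c j)) q := by
    have : (Polynomial.aeval r).comp γ = MvPolynomial.aeval (fun j ↦ c j + r * (d j - c j)) := by
      ext; simp [γ]
    simpa using congr($this q)
  let p : Ideal (MvPolynomial (Fin s) K) := RingHom.ker γ
  have hp : p.IsPrime := RingHom.ker_isPrime γ
  have hpx : p ≤ (RingHom.ker x).under _ := by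
    intro q hq
    have := hev 0 q
    rw [show γ q = 0 from hq] at this
    change x (g q) = 0
    rw [hxg]
    simpa using this.symm
  have : (RingHom.ker x).IsPrime := RingHom.ker_isPrime x
  -- Going down lifts the line to an irreducible curve in `A` that still passes through `x`.
  obtain ⟨P, hPx, hP, hPp⟩ := Ideal.exists_ideal_le_liesOver_of_le (p := p)
    (q := (RingHom.ker x).under (MvPolynomial (Fin s) K)) (RingHom.ker x) hpx
  have hmem (q) : g q ∈ P ↔ γ q = 0 := by
    have := hPp.over
    change q ∈ P.under (MvPolynomial (Fin s) K) ↔ q ∈ p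
    rw [← this]
  refine ⟨P, hP, hPx, fun hhP ↦ hd ?_, (Ideal.Quotient.mkₐ K P).comp (g.comp σ), ?_⟩
  · have h1 := hev 1 N
    rw [(hmem N).mp (P.mem_of_dvd hN hhP)] at h1
    simpa using h1.symm
  · apply RingHom.Finite.of_comp_finite (f := γ.toRingHom)
    have : ((Ideal.Quotient.mkₐ K P).comp (g.comp σ)).toRingHom.comp γ.toRingHom =
        (Ideal.Quotient.mk P).comp g.toRingHom := by
      refine RingHom.ext fun q ↦ Ideal.Quotient.eq.mpr ?_
      change g (σ (γ q)) - g q ∈ P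
      rw [← map_sub, hmem, map_sub, hγσ, sub_self]
    rw [this]
    exact (RingHom.Finite.of_surjective _ Ideal.Quotient.mk_surjective).comp hgf

end Curve

/-! ### Dedekind models of function fields of curves. -/

section DedekindModel

open Polynomial

/-- The given `t₀` need not be separating, but it bounds the transcendence degree by one, so a
separating transcendence basis has at most one element. -/
lemma exists_isSeparable_adjoin_simple (K L : Type u) [Field K] [PerfectField K] [Field L]
    [Algebra K L] [Algebra.EssFiniteType K L] (t₀ : L)
    [Algebra.IsAlgebraic (Algebra.adjoin K {t₀}) L] :
    ∃ t : L, Algebra.IsSeparable (IntermediateField.adjoin K {t}) L := by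
  obtain ⟨s, hs, hsep⟩ := exists_isTranscendenceBasis_and_isSeparable_of_perfectField K L
  have hle : s.card ≤ 1 := by
    have h1 := Algebra.IsAlgebraic.trdeg_le_cardinalMk K ({t₀} : Set L)
    rw [← hs.cardinalMk_eq_trdeg] at h1
    simpa using h1
  obtain rfl | ⟨t, ht⟩ := s.eq_empty_or_nonempty
  · refine ⟨0, ?_⟩
    rw [Finset.coe_empty, IntermediateField.adjoin_empty] at hsep
    rwa [IntermediateField.adjoin_zero]
  obtain rfl : s = {t} := Finset.eq_singleton_iff_unique_mem.mpr
    ⟨ht, fun y hy ↦ Finset.card_le_one.mp hle y hy t ht⟩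
  exact ⟨t, by rwa [Finset.coe_singleton] at hsep⟩

open scoped IntermediateField.algebraAdjoinAdjoin in
/-- The normalisation of the affine line in a finite separable extension of its function field. -/
lemma exists_dedekind_model {K L : Type u} [Field K] [Field L]
    [Algebra K L] [Algebra.EssFiniteType K L] (t : L)
    [Algebra.IsSeparable (IntermediateField.adjoin K {t}) L] :
    ∃ I : Subalgebra K L, IsDedekindDomain I ∧ Algebra.FiniteType K I ∧ IsFractionRing I L ∧
      ∀ i ∈ I, IsIntegral (Algebra.adjoin K {t}) i := by
  let R := Algebra.adjoin K {t}
  let E := IntermediateField.adjoin K {t}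
  have : Algebra.EssFiniteType E L := .of_comp K E L
  have : Algebra.FormallyUnramified E L := (Algebra.FormallyUnramified.iff_isSeparable E L).mpr ‹_›
  have : FiniteDimensional E L := Algebra.FormallyUnramified.finite_of_free E L
  have hR : Algebra.FiniteType K R := (Subalgebra.fg_iff_finiteType _).mp ⟨{t}, by simp [R]⟩
  -- `R` is a quotient of `K[X]` even when `t` is algebraic over `K`.
  have : IsPrincipalIdealRing R := by
    have hmem (q : K[X]) : aeval t q ∈ R := by
      exact aeval_mem_adjoin_singleton K t
    let f : K[X] →ₐ[K] R := (aeval t).codRestrict R hmem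
    refine IsPrincipalIdealRing.of_surjective f ?_
    rintro ⟨y, hy⟩
    obtain ⟨q, rfl⟩ := (Algebra.adjoin_singleton_eq_range_aeval K t).le hy
    exact ⟨q, rfl⟩
  have : IsFractionRing R E := inferInstance
  have : IsScalarTower R E L := inferInstance
  have hI : IsDedekindDomain (integralClosure R L) := integralClosure.isDedekindDomain R E L
  have hfin : Module.Finite R (integralClosure R L) := IsIntegralClosure.finite R E L _
  refine ⟨(integralClosure R L).restrictScalars K, hI, ?_, ?_, fun i hi ↦ hi⟩
  · let J := (integralClosure R L).restrictScalars K
    let : Algebra R J := (integralClosure R L).algebra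
    have : IsScalarTower K R J := .of_algebraMap_eq fun _ ↦ rfl
    have : Module.Finite R J := hfin
    exact Algebra.FiniteType.trans (S := R) (A := J) hR inferInstance
  · exact integralClosure.isFractionRing_of_finite_extension E L

/-- A valuation ring containing a Dedekind domain with the same fraction field is a localization
of it. -/
lemma ValuationSubring.exists_mul_eq_of_mem {D L : Type u} [CommRing D] [IsDedekindDomain D]
    [Field L] [Algebra D L] [IsFractionRing D L] (V : ValuationSubring L)
    (hV : ∀ d : D, algebraMap D L d ∈ V) {c : L} (hc : c ∈ V) :
    ∃ a b : D, V.valuation (algebraMap D L b) = 1 ∧ c * algebraMap D L b = algebraMap D L a := by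
  let j : D →+* V := (algebraMap D L).codRestrict V.toSubring hV
  -- The centre of `V` on `D`. If it is nonzero, the localization there is a discrete valuation
  -- ring, containing `c` or `c⁻¹`.
  let n : Ideal D := (IsLocalRing.maximalIdeal V).comap j
  have hn : n.IsPrime := Ideal.comap_isPrime j _
  have hmem (d : D) : d ∈ n ↔ V.valuation (algebraMap D L d) < 1 :=
    V.valuation_lt_one_iff (j d)
  have hone {d : D} (hd : d ∉ n) : V.valuation (algebraMap D L d) = 1 := by
    rw [hmem, not_lt] at hd
    exact ((V.valuation_le_one_iff _).mpr (hV d)).antisymm hd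
  have hfrac : ∃ a b : D, b ∉ n ∧ (c * algebraMap D L b = algebraMap D L a ∨
      c⁻¹ * algebraMap D L b = algebraMap D L a) := by
    by_cases hbot : n = ⊥
    · obtain ⟨a, b, hb, rfl⟩ := IsFractionRing.div_surjective (A := D) c
      have hb' : algebraMap D L b ≠ 0 := by simpa using nonZeroDivisors.ne_zero hb
      exact ⟨a, b, by simpa [hbot] using nonZeroDivisors.ne_zero hb, .inl (div_mul_cancel₀ _ hb')⟩
    · let W := Localization.subalgebra.ofField L n.primeCompl n.primeCompl_le_nonZeroDivisors
      have : IsLocalization.AtPrime W n := Localization.subalgebra.isLocalization_ofField ..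
      have : IsFractionRing W L := Localization.subalgebra.isFractionRing_ofField ..
      have : IsDiscreteValuationRing W :=
        IsLocalization.AtPrime.isDiscreteValuationRing_of_dedekind_domain D hbot W
      have key (w : W) : ∃ a b : D, b ∉ n ∧ (w : L) * algebraMap D L b = algebraMap D L a := by
        obtain ⟨⟨a, b⟩, hab⟩ := IsLocalization.surj n.primeCompl w
        exact ⟨a, b, b.2, congr(($hab : L))⟩
      rcases ValuationRing.isInteger_or_isInteger W c with ⟨w, hw⟩ | ⟨w, hw⟩
      · obtain ⟨a, b, hb, h⟩ := key w
        exact ⟨a, b, hb, .inl (by rwa [← hw])⟩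
      · obtain ⟨a, b, hb, h⟩ := key w
        exact ⟨a, b, hb, .inr (by rwa [← hw])⟩
  obtain ⟨a, b, hb, h | h⟩ := hfrac
  · exact ⟨a, b, hone hb, h⟩
  -- Here `c * a = b` with `b` a unit of `V` and `c` in `V`, which forces `a` to be a unit as well.
  · by_cases hc0 : c = 0
    · exact ⟨0, 1, by simp, by simp [hc0]⟩
    have h' : c * algebraMap D L a = algebraMap D L b := by
      rw [← h, mul_inv_cancel_left₀ hc0]
    refine ⟨b, a, hone fun ha ↦ ?_, h'⟩
    have h2 := congr(V.valuation $h')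
    rw [map_mul, hone hb] at h2
    have h3 := (V.valuation_le_one_iff c).mpr hc
    rw [hmem] at ha
    exact (mul_lt_one_of_nonneg_of_lt_one_right h3 zero_le ha).ne h2

end DedekindModel

/-! ### Normalising a curve and finding an étale coordinate. -/

section EtaleCurve

open Polynomial

variable {K : Type u} [Field K]

lemma isAlgebraic_adjoin_of_finite {C L : Type u} [CommRing C] [IsDomain C] [Algebra K C]
    [Field L] [Algebra K L] [Algebra C L] [IsScalarTower K C L] [IsFractionRing C L]
    {τ : K[X] →ₐ[K] C} (hτ : τ.toRingHom.Finite) :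
    Algebra.IsAlgebraic (Algebra.adjoin K {algebraMap C L (τ X)}) L := by
  let R := Algebra.adjoin K {algebraMap C L (τ X)}
  have hR (q : K[X]) : algebraMap C L (τ q) ∈ R := by
    have : algebraMap C L (τ q) = aeval (algebraMap C L (τ X)) q := by
      rw [aeval_algebraMap_apply, aeval_algHom_apply, aeval_X_left_apply]
    rw [this]
    exact aeval_mem_adjoin_singleton K _
  let ρ : K[X] →+* R := ((algebraMap C L).comp τ.toRingHom).codRestrict R hR
  have hint (c : C) : IsAlgebraic R (algebraMap C L c) := by
    obtain ⟨q, hqm, hq⟩ := hτ.to_isIntegral c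
    refine IsIntegral.isAlgebraic ⟨q.map ρ, hqm.map ρ, ?_⟩
    rw [eval₂_map, show (algebraMap R L).comp ρ = (algebraMap C L).comp τ.toRingHom from rfl,
      ← hom_eval₂, hq, map_zero]
  refine ⟨fun y ↦ ?_⟩
  obtain ⟨a, b, hb, rfl⟩ := IsFractionRing.div_surjective (A := C) y
  rw [div_eq_mul_inv]
  exact (hint a).mul (hint b).inv

/-- A domain is dominated, at a given prime ideal, by a valuation ring of its fraction field. -/
lemma exists_valuationSubring_dominating {C L : Type u} [CommRing C] [IsDomain C] [Field L]
    [Algebra C L] [IsFractionRing C L] (m : Ideal C) [m.IsPrime] :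
    ∃ V : ValuationSubring L, (∀ c, algebraMap C L c ∈ V) ∧
      ∀ c ∈ m, V.valuation (algebraMap C L c) < 1 := by
  let Cm := Localization.AtPrime m
  let ι : Cm →+* L := IsLocalization.lift (M := m.primeCompl) (g := algebraMap C L) fun y ↦ by
    refine IsUnit.mk0 _ ?_
    rw [Ne, FaithfulSMul.algebraMap_eq_zero_iff]
    rintro h
    exact y.2 (h ▸ m.zero_mem)
  obtain ⟨V, hιV, hloc⟩ := IsLocalRing.exists_factor_valuationRing ι
  have hCV (c : C) : algebraMap C L c ∈ V := by
    have := hιV (algebraMap C Cm c)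
    rwa [IsLocalization.lift_eq] at this
  refine ⟨V, hCV, fun c hc ↦ ?_⟩
  rw [← V.valuation_lt_one_iff ⟨_, hCV c⟩, IsLocalRing.mem_maximalIdeal, mem_nonunits_iff]
  intro hu
  have h1 : IsUnit (algebraMap C Cm c) := by
    refine hloc.map_nonunit _ ?_
    have : (⟨algebraMap C L c, hCV c⟩ : V) = ι.codRestrict V.toSubring hιV (algebraMap C Cm c) :=
      Subtype.ext (IsLocalization.lift_eq (M := m.primeCompl) _ c).symm
    rwa [this] at hu
  rw [IsLocalization.AtPrime.isUnit_to_map_iff Cm m] at h1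
  exact h1 hc

lemma mem_valuationSubring_of_isIntegral {R L : Type u} [CommRing R] [Field L] [Algebra R L]
    (V : ValuationSubring L) (hR : ∀ r, algebraMap R L r ∈ V) {y : L} (hy : IsIntegral R y) :
    y ∈ V := by
  have h1 : IsIntegral V y := by
    obtain ⟨q, hqm, hq⟩ := hy
    let ρ : R →+* V := (algebraMap R L).codRestrict V.toSubring hR
    refine ⟨q.map ρ, hqm.map ρ, ?_⟩
    rw [eval₂_map]
    exact hq
  obtain ⟨y, rfl⟩ := IsIntegrallyClosed.isIntegral_iff.mp h1
  exact y.2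

/-- If a valuation ring `V` contains a Dedekind domain `I` with the same fraction field, then
every finitely generated subalgebra of `V` is contained in a localization `I[1/g]` with `g` a unit
of `V`. -/
lemma exists_algHom_localizationAway {I C L : Type u} [CommRing I] [IsDedekindDomain I]
    [Algebra K I] [Field L] [Algebra K L] [Algebra I L] [IsScalarTower K I L] [IsFractionRing I L]
    [CommRing C] [Algebra K C] [hC : Algebra.FiniteType K C] (V : ValuationSubring L)
    (hV : ∀ i : I, algebraMap I L i ∈ V) (f : C →ₐ[K] L) (hf : ∀ c, f c ∈ V) :
    ∃ g : I, g ≠ 0 ∧ ∃ (j : Localization.Away g →ₐ[K] L) (φ : C →ₐ[K] Localization.Away g),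
      (∀ d, j d ∈ V) ∧ ∀ c, j (φ c) = f c := by
  classical
  obtain ⟨S, hS⟩ := hC.out
  choose a b hb hab using fun c : C ↦ ValuationSubring.exists_mul_eq_of_mem V hV (hf c)
  -- A common denominator, a unit of `V`, for a finite set of generators of `C`.
  let g : I := ∏ c ∈ S, b c
  have hg : V.valuation (algebraMap I L g) = 1 := by
    simp only [g, map_prod]
    exact Finset.prod_eq_one fun c _ ↦ hb c
  have hg0 : g ≠ 0 := by rintro h; simp [h] at hg
  let D := Localization.Away g
  have hgL : algebraMap I L g ≠ 0 := by simpa using hg0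
  let j : D →ₐ[K] L := IsLocalization.liftAlgHom (M := Submonoid.powers g)
    (f := IsScalarTower.toAlgHom K I L) (by
      rintro ⟨_, k, rfl⟩
      exact IsUnit.mk0 _ (by simpa using pow_ne_zero k hgL))
  have hj (i : I) : j (algebraMap I D i) = algebraMap I L i := by simp [j]
  have hfrac (d : D) : ∃ (i : I) (k : ℕ), j d * algebraMap I L g ^ k = algebraMap I L i ∧
      d * algebraMap I D (g ^ k) = algebraMap I D i := by
    obtain ⟨⟨i, _, k, rfl⟩, h⟩ := IsLocalization.surj (Submonoid.powers g) d
    refine ⟨i, k, ?_, h⟩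
    have := congr(j $h)
    rw [map_mul, hj, hj] at this
    simpa using this
  have hjinj : Function.Injective j := by
    refine (injective_iff_map_eq_zero j).mpr fun d hd ↦ ?_
    obtain ⟨i, k, h1, h2⟩ := hfrac d
    rw [hd, zero_mul, eq_comm, FaithfulSMul.algebraMap_eq_zero_iff] at h1
    rw [h1, map_zero] at h2
    have hu := IsLocalization.map_units D (⟨g ^ k, k, rfl⟩ : Submonoid.powers g)
    exact hu.mul_left_eq_zero.mp h2
  have hjV (d : D) : j d ∈ V := by
    obtain ⟨i, k, h1, -⟩ := hfrac d
    have h3 := congr(V.valuation $h1)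
    rw [map_mul, map_pow, hg, one_pow, mul_one] at h3
    rw [← V.valuation_le_one_iff, h3, V.valuation_le_one_iff]
    exact hV i
  have hjC (c : C) : f c ∈ j.range := by
    suffices ⊤ ≤ j.range.comap f from this (Algebra.mem_top (x := c))
    rw [← hS, Algebra.adjoin_le_iff]
    intro c hc
    have hdvd : b c ∣ g := Finset.dvd_prod_of_mem b hc
    obtain ⟨v, hv⟩ := isUnit_of_dvd_unit (map_dvd (algebraMap I D) hdvd)
      (IsLocalization.Away.algebraMap_isUnit (S := D) g)
    refine ⟨algebraMap I D (a c) * ↑v⁻¹, ?_⟩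
    have hbc : algebraMap I L (b c) ≠ 0 := by
      intro h
      have := hb c
      rw [h, map_zero] at this
      exact zero_ne_one this
    have hv' : j ↑v⁻¹ * algebraMap I L (b c) = 1 := by
      rw [← hj (b c), ← hv, ← map_mul, Units.inv_mul, map_one]
    apply mul_right_cancel₀ hbc
    change j _ * _ = f c * algebraMap I L (b c)
    rw [map_mul, mul_assoc, hv', mul_one, hab c, hj]
  let φ : C →ₐ[K] D :=
    (AlgEquiv.ofInjective j hjinj).symm.toAlgHom.comp (f.codRestrict j.range hjC)
  have hφ (c : C) : j (φ c) = f c :=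
    congr(($((AlgEquiv.ofInjective j hjinj).apply_symm_apply (f.codRestrict j.range hjC c)) : L))
  exact ⟨g, hg0, j, φ, hjV, hφ⟩

/-- A rational point of an affine curve lifts to the normalisation of the curve. -/
lemma exists_dedekind_lift [IsAlgClosed K] {C : Type u} [CommRing C] [IsDomain C] [Algebra K C]
    {τ : K[X] →ₐ[K] C} (hτ : τ.toRingHom.Finite) (x : C →ₐ[K] K) (hx : RingHom.ker x ≠ ⊥) :
    ∃ (D : Type u) (_ : CommRing D) (_ : IsDedekindDomain D) (_ : Algebra K D)
      (_ : Algebra.FiniteType K D) (φ : C →ₐ[K] D) (z : D →ₐ[K] K),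
      Function.Injective φ ∧ z.comp φ = x := by
  let L := FractionRing C
  have hinj : Function.Injective (algebraMap C L) := IsFractionRing.injective C L
  have hC : Algebra.FiniteType K C := by
    algebraize [τ.toRingHom]
    have : IsScalarTower K K[X] C := .of_algebraMap_eq fun r ↦ (τ.commutes r).symm
    exact Algebra.FiniteType.trans (S := K[X]) inferInstance inferInstance
  have : Algebra.EssFiniteType C L := .of_isLocalization L (nonZeroDivisors C)
  have : Algebra.EssFiniteType K L := .comp K C L
  have := isAlgebraic_adjoin_of_finite (L := L) hτ
  obtain ⟨t, ht⟩ := exists_isSeparable_adjoin_simple K L (algebraMap C L (τ X))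
  have hm : (RingHom.ker x).IsPrime := RingHom.ker_isPrime x
  obtain ⟨V, hCV, hmV⟩ := exists_valuationSubring_dominating (L := L) (RingHom.ker x)
  -- `V` contains `t` or `t⁻¹`, and both generate the same field. With the parameter in `V`, the
  -- integral closure of `K[t]` lies in `V`.
  obtain ⟨t, htV, ht⟩ : ∃ t ∈ V, Algebra.IsSeparable (IntermediateField.adjoin K {t}) L := by
    rcases V.mem_or_inv_mem t with h | h
    · exact ⟨t, h, ht⟩
    · refine ⟨t⁻¹, h, ?_⟩
      have : IntermediateField.adjoin K {t⁻¹} = IntermediateField.adjoin K {t} := by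
        apply le_antisymm <;> rw [IntermediateField.adjoin_simple_le_iff]
        · exact inv_mem (IntermediateField.mem_adjoin_simple_self K t)
        · exact inv_mem_iff.mp (IntermediateField.mem_adjoin_simple_self K t⁻¹)
      rwa [this]
  obtain ⟨I, hI, hIfin, hIfrac, hIint⟩ := exists_dedekind_model (K := K) t
  have hIV (i : I) : algebraMap I L i ∈ V := by
    refine mem_valuationSubring_of_isIntegral V (fun y ↦ ?_) (hIint i i.2)
    obtain ⟨y, hy⟩ := y
    change y ∈ V
    induction hy using Algebra.adjoin_induction with
    | mem y hy => obtain rfl := hy; exact htV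
    | algebraMap r => exact IsScalarTower.algebraMap_apply K C L r ▸ hCV _
    | add a b _ _ ha hb => exact add_mem ha hb
    | mul a b _ _ ha hb => exact mul_mem ha hb
  obtain ⟨g, hg0, j, φ, hjV, hφ⟩ :=
    exists_algHom_localizationAway V hIV (IsScalarTower.toAlgHom K C L) hCV
  have hgnz := powers_le_nonZeroDivisors_of_noZeroDivisors hg0
  let D := Localization.Away g
  have : IsDomain D := IsLocalization.isDomain_localization hgnz
  have hD : IsDedekindDomain D := IsLocalization.isDedekindDomain I hgnz D
  have : Algebra.FinitePresentation I D := .of_isLocalizationAway g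
  have hDfin : Algebra.FiniteType K D := hIfin.trans (A := D) inferInstance
  have hφinj : Function.Injective φ := fun c c' h ↦ hinj ((hφ c).symm.trans (h ▸ hφ c'))
  let jV : D →+* V := (j : D →+* L).codRestrict V.toSubring hjV
  -- The centre of `V` on `D` lies over `x`. It is nonzero because `ker x` is, hence maximal, hence
  -- a rational point.
  let n : Ideal D := (IsLocalRing.maximalIdeal V).comap jV
  have hn : n.IsPrime := Ideal.comap_isPrime jV _
  have hφn {c : C} (hc : c ∈ RingHom.ker x) : φ c ∈ n := by
    change jV (φ c) ∈ IsLocalRing.maximalIdeal V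
    rw [V.valuation_lt_one_iff]
    change V.valuation (j (φ c)) < 1
    rw [hφ]
    exact hmV c hc
  obtain ⟨c₀, hc₀, hc₀0⟩ := Submodule.exists_mem_ne_zero_of_ne_bot hx
  have hnbot : n ≠ ⊥ := fun h ↦ hc₀0 <| hφinj <| by
    rw [map_zero, ← Ideal.mem_bot, ← h]
    exact hφn hc₀
  have : n.IsMaximal := hn.isMaximal hnbot
  obtain ⟨z, hz⟩ := exists_algHom_ker_eq (K := K) n
  refine ⟨D, inferInstance, hD, inferInstance, hDfin, φ, z, hφinj, Eq.symm ?_⟩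
  refine algHom_ext_of_ker_le fun c hc ↦ ?_
  have : φ c ∈ RingHom.ker z := hz ▸ hφn hc
  exact this

/-- A smooth affine curve is étale over the affine line near each rational point. -/
lemma exists_etale_polynomial {D : Type u} [CommRing D] [IsDedekindDomain D] [Algebra K D]
    [Algebra.FiniteType K D] (z : D →ₐ[K] K) (hz : RingHom.ker z ≠ ⊥) :
    ∃ f : D, z f ≠ 0 ∧ ∃ σ : K[X] →ₐ[K] Localization.Away f, σ.toRingHom.Etale := by
  let n := RingHom.ker z
  have hn : n.IsPrime := RingHom.ker_isPrime z
  let Dn := Localization.AtPrime n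
  have : IsDiscreteValuationRing Dn :=
    IsLocalization.AtPrime.isDiscreteValuationRing_of_dedekind_domain D hz Dn
  obtain ⟨ϖ, hϖ⟩ := IsDiscreteValuationRing.exists_irreducible Dn
  obtain ⟨⟨s, u⟩, hsu⟩ := IsLocalization.surj n.primeCompl ϖ
  have hs : Ideal.span {algebraMap D Dn s} = IsLocalRing.maximalIdeal Dn := by
    rw [hϖ.maximalIdeal_eq, ← hsu]
    exact Ideal.span_singleton_mul_right_unit (IsLocalization.map_units Dn u) ϖ
  have hsn : s ∈ n := by
    rw [← IsLocalization.AtPrime.to_map_mem_maximal_iff Dn n, ← hs]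
    exact Ideal.mem_span_singleton_self _
  -- The coordinate `s` is a uniformizer at `z` up to a unit. Flatness follows from injectivity over
  -- a principal ideal domain; unramifiedness holds since `s` generates the maximal ideal and the
  -- residue field comes from `K`.
  let σ : K[X] →ₐ[K] D := aeval s
  algebraize [σ.toRingHom]
  have : IsScalarTower K K[X] D := .of_algebraMap_eq fun r ↦ (σ.commutes r).symm
  have : Algebra.FiniteType K[X] D := .of_restrictScalars_finiteType K K[X] D
  have : Algebra.FinitePresentation K[X] D := Algebra.FinitePresentation.of_finiteType.mp this
  have hs0 : s ≠ 0 := by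
    rintro rfl
    rw [map_zero, Ideal.span_singleton_zero] at hs
    exact IsDiscreteValuationRing.not_a_field Dn hs.symm
  have hσinj : Function.Injective σ := by
    refine (injective_iff_map_eq_zero σ).mpr fun q hq ↦ by_contra fun hq0 ↦ ?_
    -- After cancelling powers of `X`, evaluating the relation at `z`, where `s` vanishes, kills a
    -- nonzero constant term.
    obtain ⟨q', hq', hndvd⟩ := exists_eq_pow_rootMultiplicity_mul_and_not_dvd q hq0 0
    rw [C_0, sub_zero, X_dvd_iff] at hndvd
    rw [hq', map_mul, map_pow, C_0, sub_zero, aeval_X] at hq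
    have h1 := congr(z $((mul_eq_zero.mp hq).resolve_left (pow_ne_zero _ hs0)))
    rw [← aeval_algHom_apply, show z s = 0 from hsn, map_zero] at h1
    exact hndvd (by rw [coeff_zero_eq_aeval_zero, h1])
  have : Module.IsTorsionFree K[X] D := Module.isTorsionFree_iff_algebraMap_injective.mpr hσinj
  have : Module.Flat K[X] D := inferInstance
  let p : Ideal K[X] := Ideal.span {X}
  have hp : p.IsPrime := (Ideal.span_singleton_prime X_ne_zero).mpr prime_X
  have hover : n.LiesOver p := by
    have hpm : p.IsMaximal := PrincipalIdealRing.isMaximal_of_irreducible irreducible_X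
    refine ⟨hpm.eq_of_le (Ideal.IsPrime.under K[X] n).ne_top ?_⟩
    rw [Ideal.span_singleton_le_iff_mem]
    change σ X ∈ n
    rwa [aeval_X]
  let := Localization.AtPrime.algebraOfLiesOver p n
  have : Algebra.IsUnramifiedAt K[X] n := by
    rw [Algebra.isUnramifiedAt_iff_map_eq K[X] p n]
    constructor
    · have : n.IsMaximal := ker_algHom_isMaximal z
      refine ⟨fun y ↦ ?_⟩
      obtain ⟨d, rfl⟩ := n.algebraMap_residueField_surjective y
      have hd : algebraMap D n.ResidueField d =
          algebraMap D n.ResidueField (algebraMap K[X] D (C (z d))) := by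
        rw [← sub_eq_zero, ← map_sub, Ideal.algebraMap_residueField_eq_zero]
        change z (d - σ (C (z d))) = 0
        simp [σ]
      rw [hd, ← IsScalarTower.algebraMap_apply K[X] D n.ResidueField,
        IsScalarTower.algebraMap_apply K[X] p.ResidueField n.ResidueField]
      exact isSeparable_algebraMap _
    · rw [Ideal.map_span, Set.image_singleton, ← hs, IsScalarTower.algebraMap_apply K[X] D Dn]
      change Ideal.span {algebraMap D Dn (σ X)} = _
      rw [aeval_X]
  have := Algebra.IsEtaleAt.of_isUnramifiedAt_of_flat (R := K[X]) n
  obtain ⟨f, hf, hfe⟩ := Algebra.exists_etale_of_isEtaleAt (R := K[X]) n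
  exact ⟨f, hf, IsScalarTower.toAlgHom K K[X] _, RingHom.etale_algebraMap.mpr hfe⟩

end EtaleCurve

/-! ### Strong density of Zariski open sets. -/

section Density

open Polynomial

variable {K : Type u} [Field K]

/-- Étale homomorphisms of finitely generated `K`-algebras induce open maps on `K`-points. -/
def EtaleOpen (K : Type u) [Field K] [TopologicalSpace K] : Prop :=
  ∀ (A B : Type u) [CommRing A] [CommRing B] [Algebra K A] [Algebra K B]
    [Algebra.FiniteType K A] [Algebra.FiniteType K B] (φ : A →ₐ[K] B),
    φ.toRingHom.Etale → IsOpenMap fun y : B →ₐ[K] K ↦ y.comp φ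

/-- In dimension at most one, the kernel of a zero of `h` is a minimal prime over `(h)`, and a
noetherian ring has finitely many of these. -/
lemma finite_setOf_algHom_apply_eq_zero {D : Type u} [CommRing D] [IsDedekindDomain D]
    [Algebra K D] {h : D} (hh : h ≠ 0) : {y : D →ₐ[K] K | y h = 0}.Finite := by
  have hinj : Function.Injective fun y : D →ₐ[K] K ↦ RingHom.ker y :=
    fun y y' hy ↦ algHom_ext_of_ker_le hy.le
  refine Set.Finite.of_finite_image 
    ((Ideal.span {h}).finite_minimalPrimes_of_isNoetherianRing.subset ?_) hinj.injOn
  rintro _ ⟨y, hy, rfl⟩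
  refine ⟨⟨RingHom.ker_isPrime y, (Ideal.span_singleton_le_iff_mem _).mpr hy⟩, fun q hq hqy ↦ ?_⟩
  have hq0 : q ≠ ⊥ := by
    rintro rfl
    exact hh (by simpa using hq.2)
  have := hq.1.isMaximal hq0
  exact (this.eq_of_le (RingHom.ker_isPrime y).ne_top hqy).ge

lemma infinite_of_isOpen_polynomial_points [TopologicalSpace K] [IsTopologicalRing K] [T1Space K]
    (hK : ¬ DiscreteTopology K) {U : Set (K[X] →ₐ[K] K)} (hU : IsOpen U) (hne : U.Nonempty) :
    U.Infinite := by
  have hc : Continuous fun r : K ↦ (aeval r : K[X] →ₐ[K] K) := by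
    rw [continuous_algHom_iff]
    intro q
    simpa [coe_aeval_eq_eval] using q.continuous
  obtain ⟨y, hy⟩ := hne
  have hy' : y = aeval (y X) := by ext; simp
  have := infinite_of_isOpen hK (hU.preimage hc) ⟨y X, (by rwa [← hy'] : aeval (y X) ∈ U)⟩
  refine (this.image (f := fun r : K ↦ (aeval r : K[X] →ₐ[K] K)) ?_).mono
    (Set.image_preimage_subset _ _)
  intro r _ r' _ h
  simpa using congr($h X)

/-- A nonempty Zariski open subset of an irreducible affine variety is dense for the strong
topology. -/
lemma exists_mem_of_isOpen [TopologicalSpace K] [IsTopologicalRing K] [T1Space K] [IsAlgClosed K]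
    (hK : ¬ DiscreteTopology K) (hH : EtaleOpen K) {A : Type u} [CommRing A] [Algebra K A]
    [Algebra.FiniteType K A] (p : Ideal A) [p.IsPrime] {x : A →ₐ[K] K} (hx : p ≤ RingHom.ker x)
    {h : A} (hh : h ∉ p) {N : Set (A →ₐ[K] K)} (hN : IsOpen N) (hxN : x ∈ N) :
    ∃ x' ∈ N, p ≤ RingHom.ker x' ∧ x' h ≠ 0 := by
  by_cases hxh : x h = 0
  swap
  · exact ⟨x, hxN, hx, hxh⟩
  have : Infinite K := IsAlgClosed.instInfinite
  let xp : A ⧸ p →ₐ[K] K := Ideal.Quotient.liftₐ p x hx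
  obtain ⟨P, hP, hPx, hhP, τ, hτ⟩ := exists_prime_finite_polynomial xp
    (h := Ideal.Quotient.mk p h) (by rwa [Ne, Ideal.Quotient.eq_zero_iff_mem]) hxh
  let xP : (A ⧸ p) ⧸ P →ₐ[K] K := Ideal.Quotient.liftₐ P xp hPx
  let π : A →ₐ[K] (A ⧸ p) ⧸ P := (Ideal.Quotient.mkₐ K P).comp (Ideal.Quotient.mkₐ K p)
  have hπ : xP.comp π = x := by ext; rfl
  have hπh : π h ≠ 0 := by
    change Ideal.Quotient.mk P _ ≠ 0
    rwa [Ne, Ideal.Quotient.eq_zero_iff_mem]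
  obtain ⟨D, _, _, _, _, φ, z, hφ, hz⟩ := exists_dedekind_lift hτ xP fun hbot ↦ hπh <| by
    rw [← Ideal.mem_bot, ← hbot]
    exact hxh
  have hφh : φ (π h) ≠ 0 := by rwa [Ne, map_eq_zero_iff φ hφ]
  obtain ⟨f, hf, σ, hσ⟩ := exists_etale_polynomial z fun hbot ↦ hφh <| by
    rw [← Ideal.mem_bot, ← hbot]
    change z.comp φ (π h) = 0
    rw [hz]
    exact hxh
  have hfnz : Submonoid.powers f ≤ nonZeroDivisors D :=
    powers_le_nonZeroDivisors_of_noZeroDivisors fun h0 ↦ hf (by rw [h0, map_zero])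
  let E := Localization.Away f
  have : IsDomain E := IsLocalization.isDomain_localization hfnz
  have : IsDedekindDomain E := IsLocalization.isDedekindDomain D hfnz E
  have : Algebra.FinitePresentation D E := .of_isLocalizationAway f
  have : Algebra.FiniteType K E := Algebra.FiniteType.trans (S := D) inferInstance inferInstance
  let ψ : A →ₐ[K] E := (IsScalarTower.toAlgHom K D E).comp (φ.comp π)
  have hψh : ψ h ≠ 0 := by
    change algebraMap D E (φ (π h)) ≠ 0
    rwa [Ne, map_eq_zero_iff _ (IsLocalization.injective E hfnz)]
  let z' : E →ₐ[K] K := IsLocalization.liftAlgHom (M := Submonoid.powers f) (f := z) (by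
    rintro ⟨_, k, rfl⟩
    exact IsUnit.mk0 _ (by simpa using pow_ne_zero k hf))
  have hz' : z'.comp ψ = x := by
    rw [← hπ, ← hz]
    ext a
    simp [z', ψ]
  have hN' := hN.preimage (continuous_comp_algHom ψ)
  -- The étale coordinate sends the open set `N'` to a nonempty open, hence infinite, set of points
  -- of the line, so `N'` itself is infinite.
  have hinf := infinite_of_isOpen_polynomial_points hK (hH K[X] E σ hσ _ hN')
    ⟨_, z', by simpa [hz'] using hxN, rfl⟩
  obtain ⟨y, hyN, hy⟩ := (hinf.of_image _).exists_notMem_finite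
    (finite_setOf_algHom_apply_eq_zero (K := K) hψh)
  refine ⟨y.comp ψ, hyN, fun a ha ↦ ?_, hy⟩
  have : π a = 0 := by
    change Ideal.Quotient.mk P (Ideal.Quotient.mk p a) = 0
    rw [Ideal.Quotient.eq_zero_iff_mem.mpr ha, map_zero]
  simp [ψ, this, RingHom.mem_ker]

end Density

/-! ### From strong openness to Zariski openness. -/

section ZariskiOpen

variable {K : Type u} [Field K] [TopologicalSpace K] [IsTopologicalRing K] [T1Space K]
  [IsAlgClosed K]

/-- A point of a constructible set is the generic point of an irreducible locally closed subset. -/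
lemma exists_notMem_forall_mem_of_isConstructible {A : Type u} [CommRing A]
    {Z : Set (PrimeSpectrum A)} (hZ : Topology.IsConstructible Z) {p : PrimeSpectrum A}
    (hp : p ∈ Z) : ∃ h ∉ p.asIdeal, ∀ q : PrimeSpectrum A, p ≤ q → h ∉ q.asIdeal → q ∈ Z := by
  obtain ⟨S, rfl⟩ := PrimeSpectrum.exists_constructibleSetData_iff.mpr hZ
  simp only [PrimeSpectrum.ConstructibleSetData.toSet, Set.mem_iUnion] at hp ⊢
  obtain ⟨C, hC, hpC⟩ := hp
  refine ⟨C.f, fun h ↦ hpC.2 (by simpa using h), fun q hpq hq ↦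
    ⟨C, hC, ?_, fun h ↦ hq (by simpa using h)⟩⟩
  exact Set.Subset.trans hpC.1 hpq

lemma isOpen_comap_image_basicOpen (hK : ¬ DiscreteTopology K) (hH : EtaleOpen K)
    {A B : Type u} [CommRing A] [CommRing B] [Algebra K A] [Algebra K B]
    [Algebra.FiniteType K A] [Algebra.FiniteType K B] {φ : A →ₐ[K] B}
    (hφ : IsOpenMap fun y : B →ₐ[K] K ↦ y.comp φ) (b : B) :
    IsOpen (PrimeSpectrum.comap φ.toRingHom '' PrimeSpectrum.basicOpen b) := by
  have : IsNoetherianRing A := Algebra.FiniteType.isNoetherianRing K A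
  have hfin : φ.toRingHom.FinitePresentation := by
    refine RingHom.FinitePresentation.of_finiteType.mp ?_
    exact RingHom.FiniteType.of_comp_finiteType (f := algebraMap K A) <| by
      rw [AlgHom.toRingHom_eq_coe, AlgHom.comp_algebraMap]
      exact RingHom.finiteType_algebraMap.mpr inferInstance
  have hcons := PrimeSpectrum.isConstructible_comap_image hfin
    (PrimeSpectrum.isConstructible_basicOpen (f := b))
  set T := PrimeSpectrum.comap φ.toRingHom '' PrimeSpectrum.basicOpen b
  refine PrimeSpectrum.isOpen_of_stableUnderGeneralization_of_isConstructible ?_ hcons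
  intro q p hpq hq
  rw [← PrimeSpectrum.le_iff_specializes] at hpq
  by_contra hp
  obtain ⟨h, hhp, hh⟩ := exists_notMem_forall_mem_of_isConstructible hcons.compl hp
  obtain ⟨h', hhq, hh'⟩ := exists_notMem_forall_mem_of_isConstructible hcons hq
  -- A rational specialization `x` of `q` that stays in the constructible image `T`; it then lifts
  -- to a rational point `y` with `y b ≠ 0`.
  obtain ⟨x, hqx, hx⟩ := exists_algHom_le_ker (K := K) q.asIdeal hhq
  obtain ⟨r, hr, hrx⟩ := hh' ⟨RingHom.ker x, RingHom.ker_isPrime x⟩ hqx hx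
  obtain ⟨y, hry, hyb⟩ := exists_algHom_le_ker (K := K) r.asIdeal hr
  have hyx : y.comp φ = x := by
    symm
    refine algHom_ext_of_ker_le fun a ha ↦ ?_
    change φ a ∈ RingHom.ker y
    refine hry ?_
    have : a ∈ (PrimeSpectrum.comap φ.toRingHom r).asIdeal := hrx ▸ ha
    exact this
  have hopen : IsOpen {y : B →ₐ[K] K | y b ≠ 0} :=
    isOpen_ne.preimage (continuous_algHom_apply b)
  -- The strong image of `b ≠ 0` is a neighbourhood of `x`, so density gives a point of it in the
  -- part of the closure of `p` that misses `T`.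
  obtain ⟨_, ⟨y', hy', rfl⟩, hpy, hyh⟩ := exists_mem_of_isOpen hK hH p.asIdeal
    (x := x) (le_trans hpq hqx) hhp (hφ _ hopen) ⟨y, hyb, hyx⟩
  exact hh ⟨RingHom.ker (y'.comp φ), RingHom.ker_isPrime _⟩ hpy hyh
    ⟨⟨RingHom.ker y', RingHom.ker_isPrime y'⟩, hy', rfl⟩

lemma isOpenMap_comap_mvPolynomial_map (hK : ¬ DiscreteTopology K) (hH : EtaleOpen K)
    {A B : Type u} [CommRing A] [CommRing B] [Algebra K A] [Algebra K B]
    [Algebra.FiniteType K A] [Algebra.FiniteType K B] {φ : A →ₐ[K] B}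
    (hφ : IsOpenMap fun y : B →ₐ[K] K ↦ y.comp φ) (n : ℕ) :
    IsOpenMap (PrimeSpectrum.comap (MvPolynomial.map (σ := Fin n) φ.toRingHom)) := by
  rw [PrimeSpectrum.isBasis_basic_opens.isOpenMap_iff]
  rintro _ ⟨_, ⟨b, rfl⟩, rfl⟩
  have : Algebra.FiniteType K (MvPolynomial (Fin n) A) :=
    Algebra.FiniteType.trans (S := A) inferInstance inferInstance
  have : Algebra.FiniteType K (MvPolynomial (Fin n) B) :=
    Algebra.FiniteType.trans (S := B) inferInstance inferInstance
  exact isOpen_comap_image_basicOpen hK hH (isOpenMap_comp_mapAlgHom hφ (Fin n)) b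

end ZariskiOpen

/-! ### Universal openness tested on affine spaces. -/

section UniversallyOpen

open TensorProduct

/-- Two primes with the same restriction become kernels of homomorphisms to a common field. -/
lemma exists_field_of_comap_eq {R S T : Type u} [CommRing R] [CommRing S] [CommRing T]
    (f : R →+* S) (g : R →+* T) (p : PrimeSpectrum S) (q : PrimeSpectrum T)
    (h : PrimeSpectrum.comap f p = PrimeSpectrum.comap g q) :
    ∃ (Ω : Type u) (_ : Field Ω) (i : S →+* Ω) (j : T →+* Ω), i.comp f = j.comp g ∧
      RingHom.ker i = p.asIdeal ∧ RingHom.ker j = q.asIdeal := by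
  let r := (PrimeSpectrum.comap f p).asIdeal
  let k := r.ResidueField
  let f' : k →+* p.asIdeal.ResidueField := Ideal.ResidueField.map r p.asIdeal f rfl
  let g' : k →+* q.asIdeal.ResidueField := Ideal.ResidueField.map r q.asIdeal g congr(($h).asIdeal)
  algebraize [f', g']
  let W := p.asIdeal.ResidueField ⊗[k] q.asIdeal.ResidueField
  obtain ⟨M, hM⟩ := Ideal.exists_maximal W
  let := Ideal.Quotient.field M
  let i : p.asIdeal.ResidueField →+* W ⧸ M :=
    (Ideal.Quotient.mk M).comp Algebra.TensorProduct.includeLeftRingHom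
  let j : q.asIdeal.ResidueField →+* W ⧸ M :=
    (Ideal.Quotient.mk M).comp
      (Algebra.TensorProduct.includeRight : q.asIdeal.ResidueField →ₐ[k] W).toRingHom
  have hij : i.comp f' = j.comp g' := by
    refine RingHom.ext fun c ↦ congr(Ideal.Quotient.mk M $(?_))
    exact Algebra.TensorProduct.tmul_one_eq_one_tmul c
  refine ⟨W ⧸ M, inferInstance, i.comp (algebraMap S _), j.comp (algebraMap T _), ?_, ?_, ?_⟩
  · refine RingHom.ext fun c ↦ ?_
    have := congr($hij (algebraMap R k c))
    simp only [RingHom.comp_apply] at this ⊢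
    have hf : f' (algebraMap R k c) = algebraMap S _ (f c) := Ideal.ResidueField.map_algebraMap ..
    have hg : g' (algebraMap R k c) = algebraMap T _ (g c) := Ideal.ResidueField.map_algebraMap ..
    rwa [hf, hg] at this
  · ext s; simp [RingHom.mem_ker]
  · ext s; simp [RingHom.mem_ker]

/-- The basic open set of `∑ a i ⊗ b i` is pulled back from that of the generic element `∑ X i * b
i` over `A[X]`, along `X i ↦ a i`. Its image is the preimage of the generic image, because
compatible primes lift to the tensor product through a common field. -/
lemma isOpenMap_comap_tensorProduct {A B : Type u} [CommRing A] [CommRing B] [Algebra A B]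
    (H : ∀ n, IsOpenMap (PrimeSpectrum.comap
      (MvPolynomial.map (σ := Fin n) (algebraMap A B))))
    (A' : Type u) [CommRing A'] [Algebra A A'] :
    IsOpenMap (PrimeSpectrum.comap
      (Algebra.TensorProduct.includeLeftRingHom : A' →+* A' ⊗[A] B)) := by
  rw [PrimeSpectrum.isBasis_basic_opens.isOpenMap_iff]
  rintro _ ⟨_, ⟨w, rfl⟩, rfl⟩
  obtain ⟨n, a, b, rfl⟩ : ∃ (n : ℕ) (a : Fin n → A') (b : Fin n → B), w = ∑ i, a i ⊗ₜ[A] b i := by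
    obtain ⟨S, rfl⟩ := TensorProduct.exists_finset w
    refine ⟨S.card, fun i ↦ (S.equivFin.symm i).1.1, fun i ↦ (S.equivFin.symm i).1.2, ?_⟩
    rw [← Finset.sum_coe_sort S, ← S.equivFin.symm.sum_comp]
  let w : MvPolynomial (Fin n) B := ∑ i, .X i * .C (b i)
  let e : MvPolynomial (Fin n) A →+* A' := (MvPolynomial.aeval a).toRingHom
  let μ : MvPolynomial (Fin n) A →+* MvPolynomial (Fin n) B := MvPolynomial.map (algebraMap A B)
  let ε : MvPolynomial (Fin n) B →+* A' ⊗[A] B :=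
    MvPolynomial.eval₂Hom (Algebra.TensorProduct.includeRight : B →ₐ[A] A' ⊗[A] B).toRingHom
      fun i ↦ a i ⊗ₜ 1
  have hεw : ε w = ∑ i, a i ⊗ₜ[A] b i := by simp [ε, w]
  have hεμ : ε.comp μ = Algebra.TensorProduct.includeLeftRingHom.comp e := by
    refine MvPolynomial.ringHom_ext (fun r ↦ ?_) fun i ↦ ?_
    all_goals simp [ε, μ, e]
  convert (H n _ (PrimeSpectrum.basicOpen w).isOpen).preimage
    (PrimeSpectrum.continuous_comap e) using 1
  ext p
  constructor
  · rintro ⟨q, hq, rfl⟩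
    refine ⟨PrimeSpectrum.comap ε q, ?_, ?_⟩
    · change ε w ∉ q.asIdeal
      rwa [hεw]
    · rw [← PrimeSpectrum.comap_comp_apply, ← PrimeSpectrum.comap_comp_apply]
      exact congr(PrimeSpectrum.comap $hεμ q)
  · rintro ⟨q, hq, hqp⟩
    obtain ⟨Ω, _, i, j, hij, hi, hj⟩ := exists_field_of_comap_eq e μ p q hqp.symm
    algebraize [i.comp (algebraMap A A')]
    let iA : A' →ₐ[A] Ω := { i with commutes' := fun r ↦ rfl }
    let jB : B →ₐ[A] Ω :=
      { j.comp MvPolynomial.C with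
        commutes' := fun r ↦ by
          have := congr($hij (MvPolynomial.C r))
          simp only [RingHom.comp_apply, e, μ, MvPolynomial.map_C] at this
          simpa [RingHom.algebraMap_toAlgebra] using this.symm }
    let l : A' ⊗[A] B →ₐ[A] Ω := Algebra.TensorProduct.lift iA jB fun _ _ ↦ .all _ _
    have hlε : (l : A' ⊗[A] B →+* Ω).comp ε = j := by
      refine MvPolynomial.ringHom_ext (fun r ↦ ?_) fun m ↦ ?_
      · simp [ε, l, jB]
      · have := congr($hij (MvPolynomial.X m))
        simpa [ε, l, iA, e, μ] using this
    refine ⟨⟨RingHom.ker l, RingHom.ker_isPrime l⟩, ?_, ?_⟩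
    · change l _ ≠ 0
      rw [← hεw]
      change (l : A' ⊗[A] B →+* Ω).comp ε w ≠ 0
      rw [hlε]
      change ¬ w ∈ RingHom.ker j
      rwa [hj]
    · ext s
      change l (s ⊗ₜ 1) = 0 ↔ _
      rw [← hi]
      simp [l, iA, RingHom.mem_ker]

/-- A morphism of affine schemes all of whose base changes to affine spaces are open is universally
open. -/
lemma universallyOpen_of_isOpenMap_comap_mvPolynomial {A B : Type u} [CommRing A] [CommRing B]
    (φ : A →+* B)
    (H : ∀ n, IsOpenMap (PrimeSpectrum.comap (MvPolynomial.map (σ := Fin n) φ))) :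
    UniversallyOpen (Spec.map (CommRingCat.ofHom φ)) := by
  refine ⟨fun {X' T} snd g fst hsq ↦ ?_⟩
  change topologically IsOpenMap fst
  wlog hT : ∃ R, T = Spec R generalizing X' T
  · rw [IsZariskiLocalAtTarget.iff_of_openCover (P := topologically IsOpenMap) T.affineCover]
    intro i
    have hsq' := (IsPullback.of_hasPullback fst (T.affineCover.f i)).paste_horiz hsq.flip
    exact this _ _ _ hsq'.flip ⟨_, rfl⟩
  obtain ⟨R, rfl⟩ := hT
  obtain ⟨ψ, rfl⟩ := Spec.map_surjective g
  algebraize [φ, ψ.hom]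
  have h1 : topologically IsOpenMap (Spec.map (CommRingCat.ofHom
      (Algebra.TensorProduct.includeLeftRingHom : R →+* R ⊗[A] B))) :=
    isOpenMap_comap_tensorProduct H R
  rw [← pullbackSpecIso_inv_fst,
    MorphismProperty.cancel_left_of_respectsIso (topologically IsOpenMap)] at h1
  rw [← hsq.isoPullback_hom_fst,
    MorphismProperty.cancel_left_of_respectsIso (topologically IsOpenMap)]
  exact h1

end UniversallyOpen

/-! ### Functoriality of the strong topology. -/

section Points

variable {K : Type u} [Field K]

lemma Points.map_comp {X Y Z : Over (Spec (.of K))} (f : X ⟶ Y) (g : Y ⟶ Z) (x : Points X) :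
    x.map (f ≫ g) = (x.map f).map g := by
  ext1
  simp [Points.map]

lemma Points.map_id {X : Over (Spec (.of K))} (x : Points X) : x.map (𝟙 X) = x := by
  ext1
  simp [Points.map]

lemma Points.value_map {X Y : Over (Spec (.of K))} (f : X ⟶ Y) (x : Points X)
    (g : Γ(Y.left, ⊤)) : (x.map f).value g = x.value (f.left.appTop g) := by
  simp only [Points.value, Points.map, Scheme.Hom.comp_appTop]
  rfl

lemma Points.map_injective {X Y : Over (Spec (.of K))} (f : X ⟶ Y) [Mono f.left] :
    Function.Injective (Points.map f) := fun x y h ↦ by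
  ext1
  exact (cancel_mono f.left).mp congr(($h).hom)

variable [TopologicalSpace K]

lemma isOpen_image_map_value {W X : Over (Spec (.of K))} (i : W ⟶ X) [IsOpenImmersion i.left]
    (g : Γ(W.left, ⊤)) {V : Set K} (hV : IsOpen V) :
    IsOpen (Points.map i '' {y | y.value g ∈ V}) := by
  let U := i.left.opensRange
  let a : W ⟶ openSub X U := Over.homMk i.left.isoOpensRange.hom (by simp [U])
  let b : openSub X U ⟶ W := Over.homMk i.left.isoOpensRange.inv (by simp [U, Iso.inv_comp_eq])
  have hab : a ≫ b = 𝟙 W := by ext1; simp [a, b]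
  have hai : a ≫ openSubι X U = i := by ext1; simp [a, U]
  have hbi : b ≫ i = openSubι X U := by ext1; simp [b, U]
  refine TopologicalSpace.isOpen_generateFrom_of_mem ⟨U, b.left.appTop g, V, hV, ?_⟩
  ext x
  constructor
  · rintro ⟨y, hy, rfl⟩
    refine ⟨y.map a, ?_, by rw [← Points.map_comp, hai]⟩
    change (y.map a).value _ ∈ V
    rwa [← Points.value_map, ← Points.map_comp, hab, Points.map_id]
  · rintro ⟨y, hy, rfl⟩
    refine ⟨y.map b, ?_, by rw [← Points.map_comp, hbi]⟩
    change (y.map b).value _ ∈ V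
    rwa [Points.value_map]

lemma continuous_value {X : Over (Spec (.of K))} (g : Γ(X.left, ⊤)) :
    Continuous fun x : Points X ↦ x.value g := by
  refine ⟨fun V hV ↦ ?_⟩
  have : IsOpenImmersion (Over.Hom.left (𝟙 X)) := by rw [Over.id_left]; infer_instance
  convert isOpen_image_map_value (𝟙 X) g hV using 1
  ext x
  simp [Points.map_id]

lemma isOpenMap_map {W X : Over (Spec (.of K))} (i : W ⟶ X) [IsOpenImmersion i.left] :
    IsOpenMap (Points.map i) := by
  intro N hN
  induction hN with
  | basic N hN =>
    obtain ⟨U, g, V, hV, rfl⟩ := hN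
    have : IsOpenImmersion (openSubι W U ≫ i).left := by
      rw [Over.comp_left]
      exact inferInstanceAs (IsOpenImmersion (U.ι ≫ i.left))
    convert isOpen_image_map_value (openSubι W U ≫ i) g hV using 1
    rw [Set.image_image]
    simp only [Points.map_comp]
  | univ => simpa using isOpen_image_map_value i 0 isOpen_univ
  | inter s t _ _ hs ht =>
    rw [Set.image_inter (Points.map_injective i)]
    exact hs.inter ht
  | sUnion S _ hS =>
    rw [Set.image_sUnion]
    exact isOpen_sUnion fun _ ⟨s, hs, h⟩ ↦ h ▸ hS s hs

lemma continuous_map {X Y : Over (Spec (.of K))} (f : X ⟶ Y) : Continuous (Points.map f) := by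
  refine continuous_generateFrom_iff.mpr ?_
  rintro _ ⟨U, g, V, hV, rfl⟩
  let f' : openSub X (f.left ⁻¹ᵁ U) ⟶ openSub Y U := Over.homMk (f.left ∣_ U) (by
    simp)
  have hsq : f' ≫ openSubι Y U = openSubι X (f.left ⁻¹ᵁ U) ≫ f := by
    ext1; simp [f']
  refine TopologicalSpace.isOpen_generateFrom_of_mem ⟨f.left ⁻¹ᵁ U, f'.left.appTop g, V, hV, ?_⟩
  ext x
  constructor
  · rintro ⟨y, hy, hyx⟩
    -- The fibre square of the restriction to `U` lifts a point of `X` mapping into `U` to a point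
    -- of the preimage of `U`.
    have hpb := (isPullback_morphismRestrict f.left U).flip
    have hw : x.hom ≫ f.left = y.hom ≫ U.ι := congr(($hyx).hom).symm
    let x' : Points (openSub X (f.left ⁻¹ᵁ U)) := ⟨hpb.lift x.hom y.hom hw, by
      change _ ≫ (f.left ⁻¹ᵁ U).ι ≫ X.hom = _
      rw [← Category.assoc, hpb.lift_fst, x.w]⟩
    have hx' : x'.map f' = y := by
      ext1
      exact hpb.lift_snd ..
    refine ⟨x', ?_, ?_⟩
    · change x'.value _ ∈ V
      rwa [← Points.value_map, hx']
    · ext1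
      exact hpb.lift_fst ..
  · rintro ⟨y, hy, rfl⟩
    refine ⟨y.map f', ?_, ?_⟩
    · change (y.map f').value _ ∈ V
      rwa [Points.value_map]
    · rw [← Points.map_comp, ← Points.map_comp, hsq]

end Points

/-! ### Comparison with pointwise convergence on affine schemes. -/

section Affine

variable {K : Type u} [Field K] {A B : Type u} [CommRing A] [Algebra K A] [CommRing B] [Algebra K B]

variable (K A) in
/-- The spectrum of a `K`-algebra as a `K`-scheme. -/
noncomputable abbrev specOver : Over (Spec (.of K)) :=
  Over.mk (Spec.map (CommRingCat.ofHom (algebraMap K A)))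

/-- The morphism of `K`-schemes induced by a homomorphism of `K`-algebras. -/
noncomputable abbrev specOverMap (φ : A →ₐ[K] B) : specOver K B ⟶ specOver K A :=
  Over.homMk (Spec.map (CommRingCat.ofHom φ.toRingHom)) (by
    simp [← Spec.map_comp, ← CommRingCat.ofHom_comp])

/-- The `K`-point of `Spec A` given by a homomorphism `A →ₐ[K] K`. -/
noncomputable def specPoint (x : A →ₐ[K] K) : Points (specOver K A) where
  hom := Spec.map (CommRingCat.ofHom x.toRingHom)
  w := by
    simp [← Spec.map_comp, ← CommRingCat.ofHom_comp]

lemma specPoint_comp (φ : A →ₐ[K] B) (y : B →ₐ[K] K) :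
    specPoint (y.comp φ) = (specPoint y).map (specOverMap φ) := by
  ext1
  exact Spec.map_comp (CommRingCat.ofHom φ.toRingHom) (CommRingCat.ofHom y.toRingHom)

lemma value_specPoint (x : A →ₐ[K] K) (g : Γ((specOver K A).left, ⊤)) :
    (specPoint x).value g = x ((Scheme.ΓSpecIso (.of A)).hom g) := by
  have := Scheme.ΓSpecIso_naturality (CommRingCat.ofHom x.toRingHom)
  exact congr($this g)

lemma specPoint_bijective : Function.Bijective (specPoint : (A →ₐ[K] K) → _) := by
  constructor
  · intro x y h
    have := Spec.map_injective congr(($h).hom)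
    ext a
    exact congr($this a)
  · rintro ⟨y, hy⟩
    obtain ⟨ψ, rfl⟩ := Spec.map_surjective y
    refine ⟨{ ψ.hom with commutes' := fun r ↦ ?_ }, rfl⟩
    replace hy : Spec.map ψ ≫ Spec.map (CommRingCat.ofHom (algebraMap K A)) = 𝟙 _ := hy
    rw [← Spec.map_id, ← Spec.map_comp] at hy
    exact congr($(Spec.map_injective hy) r)

lemma isFiniteType_specOver [h : Algebra.FiniteType K A] : IsFiniteType (specOver K A) :=
  ⟨(HasRingHomProperty.Spec_iff (P := @LocallyOfFiniteType)).mpr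
    (RingHom.finiteType_algebraMap.mpr h),
    inferInstanceAs (QuasiCompact (Spec.map (CommRingCat.ofHom (algebraMap K A))))⟩

variable [TopologicalSpace K]

/-- The inverse is continuous because evaluation at `a` is the value of a global function. -/
lemma isOpenMap_specPoint : IsOpenMap (specPoint : (A →ₐ[K] K) → _) := by
  let e := Equiv.ofBijective _ (specPoint_bijective (K := K) (A := A))
  have hc : Continuous e.symm := by
    rw [continuous_algHom_iff]
    intro a
    convert continuous_value (X := specOver K A) ((Scheme.ΓSpecIso (.of A)).inv a) with y
    obtain ⟨x, rfl⟩ := e.surjective y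
    rw [e.symm_apply_apply]
    change _ = (specPoint x).value _
    rw [value_specPoint]
    simp
  intro N hN
  have : specPoint '' N = e.symm ⁻¹' N := e.image_eq_preimage_symm N
  rw [this]
  exact hN.preimage hc

/-- Near a given point, a regular function on a Zariski open set is a fraction `c / a ^ n` on some
basic open set, and division in `K` is continuous away from zero. -/
lemma continuous_specPoint [IsTopologicalDivisionRing K] [T1Space K] :
    Continuous (specPoint : (A →ₐ[K] K) → _) := by
  refine continuous_generateFrom_iff.mpr ?_
  rintro _ ⟨U, g, V, hV, rfl⟩
  rw [isOpen_iff_mem_nhds]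
  rintro x₀ ⟨y₀, hy₀, hyx₀⟩
  let U' : TopologicalSpace.Opens (PrimeSpectrum A) := U
  obtain ⟨a, ha, haU⟩ : ∃ a : A, x₀ a ≠ 0 ∧
      (PrimeSpectrum.basicOpen a : Set (PrimeSpectrum A)) ⊆ U' := by
    have hmem : (⟨RingHom.ker x₀, RingHom.ker_isPrime x₀⟩ : PrimeSpectrum A) ∈ U' := by
      have h1 : (specPoint x₀).hom (⊥ : PrimeSpectrum K) ∈ U := by
        rw [← hyx₀]
        exact (y₀.hom (⊥ : PrimeSpectrum K)).2
      exact h1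
    obtain ⟨_, ⟨_, ⟨a, rfl⟩, rfl⟩, ha, haU⟩ :=
      PrimeSpectrum.isBasis_basic_opens.exists_subset_of_mem_open hmem U'.isOpen
    exact ⟨a, ha, haU⟩
  let E := Localization.Away a
  let i : specOver K E ⟶ specOver K A := specOverMap (IsScalarTower.toAlgHom K A E)
  have : IsOpenImmersion i.left :=
    inferInstanceAs (IsOpenImmersion (Spec.map (CommRingCat.ofHom (algebraMap A E))))
  have hrange : Set.range i.left ⊆ Set.range U.ι := by
    rw [Scheme.Opens.range_ι]
    refine Set.Subset.trans (Eq.subset ?_) haU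
    exact PrimeSpectrum.localization_away_comap_range E a
  let k : specOver K E ⟶ openSub (specOver K A) U :=
    Over.homMk (IsOpenImmersion.lift U.ι i.left hrange) (by
      change _ ≫ U.ι ≫ (specOver K A).hom = _
      rw [← Category.assoc, IsOpenImmersion.lift_fac, Over.w])
  have hk : k ≫ openSubι (specOver K A) U = i := by
    ext1
    exact IsOpenImmersion.lift_fac ..
  obtain ⟨⟨c, _, n, rfl⟩, hc⟩ := IsLocalization.surj (Submonoid.powers a)
    ((Scheme.ΓSpecIso (.of E)).hom (k.left.appTop g) : E)
  have key (x : A →ₐ[K] K) (hx : x a ≠ 0) : ∃ y : Points (openSub (specOver K A) U),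
      y.map (openSubι _ U) = specPoint x ∧ y.value g = x c / x a ^ n := by
    let x' : E →ₐ[K] K := IsLocalization.liftAlgHom (M := Submonoid.powers a) (f := x) (by
      rintro ⟨_, k, rfl⟩
      exact IsUnit.mk0 _ (by simpa using pow_ne_zero k hx))
    have hx' (b : A) : x' (algebraMap A E b) = x b := by simp [x']
    refine ⟨(specPoint x').map k, ?_, ?_⟩
    · rw [← Points.map_comp, hk, ← specPoint_comp]
      congr 1
      ext b
      exact hx' b
    · rw [Points.value_map, value_specPoint, eq_div_iff (pow_ne_zero n hx)]
      have := congr(x' $hc)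
      rwa [map_mul, hx', hx', map_pow] at this
  have hmono : Mono (openSubι (specOver K A) U).left := inferInstanceAs (Mono U.ι)
  obtain ⟨y, hyx, hy⟩ := key x₀ ha
  obtain rfl : y = y₀ := Points.map_injective (openSubι (specOver K A) U) (hyx.trans hyx₀.symm)
  have hcont : ContinuousAt (fun x : A →ₐ[K] K ↦ x c / x a ^ n) x₀ :=
    (continuous_algHom_apply c).continuousAt.div₀
      ((continuous_algHom_apply a).continuousAt.pow n) (pow_ne_zero n ha)
  have hV' : V ∈ nhds (x₀ c / x₀ a ^ n) := hV.mem_nhds (hy ▸ hy₀)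
  filter_upwards [(isOpen_ne.preimage (continuous_algHom_apply a)).mem_nhds ha,
    hcont.preimage_mem_nhds hV'] with x hxa hxV
  obtain ⟨y, hyx, hy⟩ := key x hxa
  refine ⟨y, ?_, hyx⟩
  change y.value g ∈ V
  rw [hy]
  exact hxV

lemma isOpenMap_comp_iff [IsTopologicalDivisionRing K] [T1Space K] (φ : A →ₐ[K] B) :
    IsOpenMap (fun y : B →ₐ[K] K ↦ y.comp φ) ↔ IsOpenMap (Points.map (specOverMap φ)) := by
  let eA := (Equiv.ofBijective _
    (specPoint_bijective (K := K) (A := A))).toHomeomorphOfContinuousOpen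
    continuous_specPoint isOpenMap_specPoint
  let eB := (Equiv.ofBijective _
    (specPoint_bijective (K := K) (A := B))).toHomeomorphOfContinuousOpen
    continuous_specPoint isOpenMap_specPoint
  have : eA ∘ (fun y : B →ₐ[K] K ↦ y.comp φ) = Points.map (specOverMap φ) ∘ eB :=
    funext (specPoint_comp φ)
  constructor
  · intro h
    have h2 : Points.map (specOverMap φ) = (Points.map (specOverMap φ) ∘ eB) ∘ eB.symm := by
      ext1; simp
    rw [h2, ← this]
    exact (eA.isOpenMap.comp h).comp eB.symm.isOpenMap
  · intro h
    have h2 : (fun y : B →ₐ[K] K ↦ y.comp φ) = eA.symm ∘ eA ∘ (fun y : B →ₐ[K] K ↦ y.comp φ) := by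
      ext1; simp
    rw [h2, this]
    exact eA.symm.isOpenMap.comp (h.comp eB.isOpenMap)

lemma ConditionH.etaleOpen [IsTopologicalDivisionRing K] [T1Space K] (hH : ConditionH K) :
    EtaleOpen K := by
  intro A B _ _ _ _ _ _ φ hφ
  rw [isOpenMap_comp_iff]
  exact hH _ _ isFiniteType_specOver isFiniteType_specOver _
    ((HasRingHomProperty.Spec_iff (P := @Etale)).mpr hφ)

end Affine

/-! ### Reduction to affine charts and conclusion. -/

section Main

variable {K : Type u} [Field K]

/-- The structure homomorphism of the ring of functions on an open subset of a `K`-scheme. -/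
noncomputable def structureHom (X : Over (Spec (.of K))) (U : X.left.Opens) : K →+* Γ(X.left, U) :=
  ((Scheme.ΓSpecIso (.of K)).inv ≫ X.hom.appLE ⊤ U le_top).hom

lemma specMap_structureHom (X : Over (Spec (.of K))) {U : X.left.Opens} (hU : IsAffineOpen U) :
    hU.fromSpec ≫ X.hom = Spec.map (CommRingCat.ofHom (structureHom X U)) := by
  rw [← IsAffineOpen.SpecMap_appLE_fromSpec X.hom (isAffineOpen_top _) hU le_top,
    IsAffineOpen.fromSpec_top, Scheme.isoSpec_Spec_inv, ← Spec.map_comp]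
  rfl

lemma finiteType_structureHom (X : Over (Spec (.of K))) (hX : IsFiniteType X) {U : X.left.Opens}
    (hU : IsAffineOpen U) : (structureHom X U).FiniteType := by
  have := hX.1
  have h := X.hom.finiteType_appLE (isAffineOpen_top _) hU le_top
  exact h.comp (RingHom.FiniteType.of_surjective _
    (ConcreteCategory.bijective_of_isIso (Scheme.ΓSpecIso (.of K)).inv).surjective)

lemma appLE_structureHom {X Y : Over (Spec (.of K))} (f : X ⟶ Y) (U : Y.left.Opens)
    (V : X.left.Opens) (e : V ≤ f.left ⁻¹ᵁ U) (r : K) :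
    f.left.appLE U V e (structureHom Y U r) = structureHom X V r := by
  have h : Y.hom.appLE ⊤ U le_top ≫ f.left.appLE U V e = X.hom.appLE ⊤ V le_top := by
    refine (Scheme.Hom.appLE_comp_appLE f.left Y.hom ⊤ U V le_top e).trans ?_
    have aux (q : X.left ⟶ Spec (.of K)) (hq : q = X.hom) (h) :
        q.appLE ⊤ V h = X.hom.appLE ⊤ V le_top := by
      subst hq; rfl
    exact aux _ (Over.w f) _
  exact congr($h ((Scheme.ΓSpecIso (.of K)).inv r))

theorem universallyOpen_of_isOpenMap [TopologicalSpace K] [IsTopologicalDivisionRing K]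
    [T1Space K] [IsAlgClosed K] (hK : ¬ DiscreteTopology K) (hH : EtaleOpen K)
    {X Y : Over (Spec (.of K))} (hX : IsFiniteType X) (hY : IsFiniteType Y) (f : X ⟶ Y)
    (hf : IsOpenMap (Points.map f)) : UniversallyOpen f.left := by
  have := HasRingHomProperty.of_isZariskiLocalAtSource_of_isZariskiLocalAtTarget @UniversallyOpen
  rw [HasRingHomProperty.iff_appLE (P := @UniversallyOpen)]
  intro ⟨U, hU⟩ ⟨V, hV⟩ e
  algebraize [structureHom Y U, structureHom X V]
  have : Algebra.FiniteType K Γ(Y.left, U) := finiteType_structureHom Y hY hU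
  have : Algebra.FiniteType K Γ(X.left, V) := finiteType_structureHom X hX hV
  let φ : Γ(Y.left, U) →ₐ[K] Γ(X.left, V) :=
    { (f.left.appLE U V e).hom with commutes' := appLE_structureHom f U V e }
  let iU : specOver K Γ(Y.left, U) ⟶ Y := Over.homMk hU.fromSpec (specMap_structureHom Y hU)
  let iV : specOver K Γ(X.left, V) ⟶ X := Over.homMk hV.fromSpec (specMap_structureHom X hV)
  have : IsOpenImmersion iU.left := hU.isOpenImmersion_fromSpec
  have : IsOpenImmersion iV.left := hV.isOpenImmersion_fromSpec
  have hsq : specOverMap φ ≫ iU = iV ≫ f := by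
    ext1
    exact IsAffineOpen.SpecMap_appLE_fromSpec f.left hU hV e
  have hφ : IsOpenMap (Points.map (specOverMap φ)) := by
    intro N hN
    -- The image of `N` on the affine chart is the preimage under `iU` of its image in `Y`, since
    -- `iU` is injective on points.
    have h1 := (hf _ (isOpenMap_map iV N hN)).preimage (continuous_map iU)
    convert h1 using 1
    rw [← Set.preimage_image_eq (Points.map (specOverMap φ) '' N) (Points.map_injective iU)]
    simp only [Set.image_image, ← Points.map_comp, hsq]
  rw [← isOpenMap_comp_iff] at hφ
  exact universallyOpen_of_isOpenMap_comap_mvPolynomial φ.toRingHom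
    (isOpenMap_comap_mvPolynomial_map hK hH hφ)

end Main

end StrongTopology

theorem mainTheorem3 (K : Type u) [Field K] [TopologicalSpace K] [IsTopologicalDivisionRing K]
    [IsAlgClosed K] [NontrivialTopology K] (hnotdiscrete : ¬ DiscreteTopology K)
    (hH : StrongTopology.ConditionH K)
    (X Y : Over (Spec (.of K)))
    (hX : StrongTopology.IsFiniteType X) (hY : StrongTopology.IsFiniteType Y)
    (f : X ⟶ Y) (hf : IsOpenMap (StrongTopology.Points.map f)) :
    UniversallyOpen f.left := by
  have : T1Space K := StrongTopology.t1Space_of_nontrivialTopology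
  exact StrongTopology.universallyOpen_of_isOpenMap hnotdiscrete hH.etaleOpen hX hY f hf
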